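/- Let $V$ be a real-analytic $n$-dimensional manifold with a real-analytic Lorentzian metric $\mathbf g$ of signature $(+,-,\dots,-)$ and a causal (time) orientation. Let $\Theta^+_x\subset T_xV$ be the set of future-directed causal (i.e. $\mathbf g(v,v)\ge 0$, $v\neq 0$) vectors at $x$. A diffeomorphism $\varphi$ of $V$ is a *causal symmetry* if its push-forward $\varphi'$ satisfies $\varphi'(\Theta^+_x)\subseteq\Theta^+_{\varphi(x)}$ for every $x\in V$. For a causal symmetry $\varphi$ let $$\mu(\varphi)|_x=\{k\in\Theta^+_x:\ (\varphi^*\mathbf g)|_x(k,k)=0\}$$ be its set of canonical null directions at $x$ and put $$\mathcal U_\varphi=\{x:\ \mu(\varphi)|_x=\emptyset\},\qquad \mathcal N_\varphi=\bigcup_{m\ge 1}\mathcal N^m_\varphi,$$ $$\mathcal N^m_\varphi=\{x:\ \text{the null eigenvectors of }(\varphi^*\mathbf g)|_x\text{ relative to }\mathbf g|_x\text{ span a space of dimension } m\}.$$ Let $I\subseteq\mathbb R$ be an interval containing $0$ and let $\{\varphi_s\}_{s\in I}$ be diffeomorphisms of $V$ with $\varphi_0=\mathrm{Id}$, $\varphi_{s+t}=\varphi_s\circ\varphi_t$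 whenever $s,t,s+t\in I$, and such that $(s,x)\mapsto\varphi_s(x)$ is real analytic on $I\times V$. Assume that $\varphi_s$ is a causal symmetry for every $s\in I$ with $s\ge 0$. Then: 1. for all $s_0,s_1\in I$ with $s_0,s_1>0$, all $x\in V$ and all $m$, one has $\mu(\varphi_{s_0})|_x=\mu(\varphi_{s_1})|_x=:\mu|_x$, $\mathcal U_{\varphi_{s_0}}=\mathcal U_{\varphi_{s_1}}=:\mathcal U$, $\mathcal N^m_{\varphi_{s_0}}=\mathcal N^m_{\varphi_{s_1}}=:\mathcal N^m$ and $\mathcal N_{\varphi_{s_0}}=\mathcal N_{\varphi_{s_1}}=:\mathcal N$; 2. if $I$ contains a positive number, then for every $s\in I$ (of either sign), $\varphi_s(\mathcal U)=\mathcal U$, $\varphi_s(\mathcal N^m)=\mathcal N^m$ for all $m$, and $\varphi_s(\mathcal N)=\mathcal N$; moreover, for every $x\in V$ the push-forward $\varphi_s'$ maps $\mu|_x$ bijectively onto $\mu|_{\varphi_s(x)}$. -/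

import Mathlib

open scoped Manifold ContDiff Bundle

noncomputable section

namespace CausalSymmetry

variable {n : ℕ} {V : Type*} [TopologicalSpace V] [ChartedSpace (EuclideanSpace ℝ (Fin n)) V]

variable (n V) in
/-- A real-analytic Lorentzian metric of signature `(+,-,…,-)` on an analytic `n`-manifold `V`.
The signature is expressed by the existence, at each point, of a vector of positive square whose
orthogonal complement is negative definite (in particular the form is nondegenerate). -/
structure AnalyticLorentzMetric [IsManifold (𝓡 n) ω V] where
  /-- the bilinear form on each tangent space -/
  val : ∀ x : V, TangentSpace (𝓡 n) x →L[ℝ] TangentSpace (𝓡 n) x →L[ℝ] ℝ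
  symm : ∀ (x : V) (v w : TangentSpace (𝓡 n) x), val x v w = val x w v
  signature : ∀ x : V, ∃ u : TangentSpace (𝓡 n) x, 0 < val x u u ∧
    ∀ v : TangentSpace (𝓡 n) x, val x u v = 0 → v ≠ 0 → val x v v < 0
  analytic : ContMDiff (𝓡 n)
    ((𝓡 n).prod 𝓘(ℝ, EuclideanSpace ℝ (Fin n) →L[ℝ] EuclideanSpace ℝ (Fin n) →L[ℝ] ℝ)) ω
    (fun x ↦ Bundle.TotalSpace.mk'
      (EuclideanSpace ℝ (Fin n) →L[ℝ] EuclideanSpace ℝ (Fin n) →L[ℝ] ℝ)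
      (E := fun x : V ↦ TangentSpace (𝓡 n) x →L[ℝ] TangentSpace (𝓡 n) x →L[ℝ] ℝ) x (val x))

/-- A causal (time) orientation: a continuous vector field that is timelike everywhere and is
declared to be future-directed. -/
structure CausalOrientation [IsManifold (𝓡 n) ω V] (g : AnalyticLorentzMetric n V) where
  /-- the future-directed timelike vector field -/
  field : ∀ x : V, TangentSpace (𝓡 n) x
  timelike : ∀ x : V, 0 < g.val x (field x) (field x)
  continuous : Continuous (fun x ↦ (⟨x, field x⟩ : TangentBundle (𝓡 n) V))

variable [IsManifold (𝓡 n) ω V] {g : AnalyticLorentzMetric n V}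

/-- `Θ⁺_x`: the future-directed causal vectors at `x` (the zero vector is excluded). -/
def futureCone (o : CausalOrientation g) (x : V) : Set (TangentSpace (𝓡 n) x) :=
  {v | 0 ≤ g.val x v v ∧ 0 < g.val x (o.field x) v}

/-- A diffeomorphism of `V` is a causal symmetry if its differential maps future-directed causal
vectors to future-directed causal vectors. -/
def IsCausalSymmetry (o : CausalOrientation g) (φ : V ≃ₘ⟮𝓡 n, 𝓡 n⟯ V) : Prop :=
  ∀ x : V, ∀ v ∈ futureCone o x, mfderiv (𝓡 n) (𝓡 n) φ x v ∈ futureCone o (φ x)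

variable (g) in
/-- The pull-back `φ^* g` at the point `x`. -/
def pullbackMetric (φ : V ≃ₘ⟮𝓡 n, 𝓡 n⟯ V) (x : V) :
    LinearMap.BilinForm ℝ (TangentSpace (𝓡 n) x) :=
  LinearMap.mk₂ ℝ
    (fun u v ↦ g.val (φ x) (mfderiv (𝓡 n) (𝓡 n) φ x u) (mfderiv (𝓡 n) (𝓡 n) φ x v))
    (fun u u' v ↦ by simp) (fun c u v ↦ by simp) (fun u v v' ↦ by simp) (fun c u v ↦ by simp)

/-- `μ(T)`: the principal directions of a covariant rank-2 tensor `T` at `x`, i.e. the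
future-directed causal vectors `u` with `T(u,u) = 0`. -/
def principalDirections (o : CausalOrientation g) {x : V}
    (T : LinearMap.BilinForm ℝ (TangentSpace (𝓡 n) x)) :
    Set (TangentSpace (𝓡 n) x) :=
  {u ∈ futureCone o x | T u u = 0}

variable (g) in
/-- The null eigenvectors at `x` of a covariant rank-2 tensor `T`, i.e. of the endomorphism
obtained by raising an index of `T` with the metric. -/
def nullEigenvectors {x : V}
    (T : LinearMap.BilinForm ℝ (TangentSpace (𝓡 n) x)) :
    Set (TangentSpace (𝓡 n) x) :=
  {k | k ≠ 0 ∧ g.val x k k = 0 ∧ ∃ c : ℝ, ∀ v : TangentSpace (𝓡 n) x, T v k = c * g.val x v k}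

/-- `μ(φ^* g|_x)`: the canonical null directions of `φ` at `x`. -/
def canonicalNullDirections (o : CausalOrientation g) (φ : V ≃ₘ⟮𝓡 n, 𝓡 n⟯ V) (x : V) :
    Set (TangentSpace (𝓡 n) x) :=
  principalDirections o (pullbackMetric g φ x)

/-- `𝒰_φ`: the points at which `φ` has no canonical null direction. -/
def setU (o : CausalOrientation g) (φ : V ≃ₘ⟮𝓡 n, 𝓡 n⟯ V) : Set V :=
  {x | canonicalNullDirections o φ x = ∅}

variable (g) in
/-- `𝒩^m_φ`: the points at which the maximal number of linearly independent null eigenvectors of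
`φ^* g` is `m`. -/
def setN (φ : V ≃ₘ⟮𝓡 n, 𝓡 n⟯ V) (m : ℕ) : Set V :=
  {x | Module.finrank ℝ (Submodule.span ℝ (nullEigenvectors g (pullbackMetric g φ x))) = m}

variable (g) in
/-- `𝒩_φ`: the union of the sets `𝒩^m_φ`, `m ≥ 1`. -/
def setNUnion (φ : V ≃ₘ⟮𝓡 n, 𝓡 n⟯ V) : Set V :=
  ⋃ m : ℕ, ⋃ _ : 1 ≤ m, setN g φ m

/-- A (local) real-analytic one-parameter group `{φ_s}_{s ∈ J}` of diffeomorphisms of `V`, where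
`J` is an interval containing `0`. The values `φ s` with `s ∉ J` play no role. -/
structure IsAnalyticOneParameterGroup (J : Set ℝ) (φ : ℝ → (V ≃ₘ⟮𝓡 n, 𝓡 n⟯ V)) : Prop where
  interval : J.OrdConnected
  zero_mem : (0 : ℝ) ∈ J
  map_zero : ∀ x : V, φ 0 x = x
  map_add : ∀ s ∈ J, ∀ t ∈ J, s + t ∈ J → ∀ x : V, φ (s + t) x = φ s (φ t x)
  analytic : ContMDiffOn (𝓘(ℝ, ℝ).prod (𝓡 n)) (𝓡 n) ω (fun p : ℝ × V ↦ φ p.1 p.2)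
    (J ×ˢ Set.univ)

end CausalSymmetry

end

/-! Let `k` be a canonical null direction of `φ s`, `s > 0`. For `0 ≤ r ≤ s` write `φ s` as `φ (s -
r)` after `φ r`. A causal symmetry sends future timelike vectors to timelike ones
(`pos_of_mapsTo_causalCone`), so the push-forward of `k` by `φ r` must already be null. Thus the
function sending `r` to the pull-back of `g` by `φ r` at `(k, k)` vanishes on `[0, s]`. It is
analytic, so it vanishes on all of `J` (`pullback_null`), and `μ` is the same for all positive
parameters.

The pull-back is nonnegative on the future cone, so its zeros there are minima and hence
eigenvectors (`exists_eigenvalue`). The null eigenvectors are therefore exactly `μ ∪ -μ`, and the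
sets `𝒩^m` depend on `μ` alone.

Invariance under the flow reduces to `φ t` permuting `μ`. The same identity principle gives this
when `2t ∈ J`; halving covers all positive parameters, and small backward steps cover the negative
ones. -/

section

open Filter Topology

namespace CausalSymmetry

/-! ### Linear algebra of Lorentzian forms. -/

section LorentzForm

variable {E : Type*} [AddCommGroup E] [Module ℝ E] [TopologicalSpace E]

/-- The form `B` is symmetric of signature `(+,-,…,-)`. -/
structure IsLorentz (B : E →L[ℝ] E →L[ℝ] ℝ) : Prop where
  symm : ∀ v w, B v w = B w v
  signature : ∃ u, 0 < B u u ∧ ∀ v, B u v = 0 → v ≠ 0 → B v v < 0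

/-- The causal vectors of `B` in the half-space determined by `τ`. -/
def causalCone (B : E →L[ℝ] E →L[ℝ] ℝ) (τ : E) : Set E :=
  {v | 0 ≤ B v v ∧ 0 < B τ v}

variable {B : E →L[ℝ] E →L[ℝ] ℝ}

theorem IsLorentz.neg_of_orthogonal (hB : IsLorentz B) {w v : E} (hw : 0 < B w w)
    (hwv : B w v = 0) (hv : v ≠ 0) : B v v < 0 := by
  obtain ⟨u, huu, hu⟩ := hB.signature
  by_contra! h
  have hvw : B v w = 0 := by rw [hB.symm, hwv]
  -- This combination is orthogonal to `u`, yet its square is nonnegative if `B v v` is.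
  have hz0 : B u w • v - B u v • w = 0 := by
    by_contra hz
    have h1 := hu (B u w • v - B u v • w) (by simp; ring) hz
    have h2 : B (B u w • v - B u v • w) (B u w • v - B u v • w)
        = B u w ^ 2 * B v v + B u v ^ 2 * B w w := by
      simp [hwv, hvw]; ring
    have h3 : 0 ≤ B u w ^ 2 * B v v + B u v ^ 2 * B w w := by positivity
    linarith
  have h1 : B u v = 0 := by
    have h2 : B w (B u w • v - B u v • w) = 0 := by rw [hz0, map_zero]
    simpa [hwv, hw.ne'] using h2
  have h2 : B u w = 0 := by simpa [h1, hv] using hz0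
  have hw0 : w ≠ 0 := by rintro rfl; simp at hw
  exact absurd (hu w h2 hw0) (not_lt.2 hw.le)

theorem IsLorentz.ne_zero_of_causal (hB : IsLorentz B) {τ k : E} (hτ : 0 < B τ τ)
    (hk : 0 ≤ B k k) (hk0 : k ≠ 0) : B τ k ≠ 0 := fun h ↦
  absurd (hB.neg_of_orthogonal hτ h hk0) (not_lt.2 hk)

theorem IsLorentz.mem_causalCone_or_neg_mem (hB : IsLorentz B) {τ k : E} (hτ : 0 < B τ τ)
    (hk : 0 ≤ B k k) (hk0 : k ≠ 0) : k ∈ causalCone B τ ∨ -k ∈ causalCone B τ := by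
  rcases (hB.ne_zero_of_causal hτ hk hk0).lt_or_gt with h | h
  · exact Or.inr ⟨by simpa using hk, by simpa using h⟩
  · exact Or.inl ⟨hk, h⟩

/-- A linear surjection mapping future causal vectors to future causal vectors maps
future timelike vectors to timelike vectors. -/
theorem IsLorentz.pos_of_mapsTo_causalCone {F : Type*} [AddCommGroup F] [Module ℝ F]
    [TopologicalSpace F] {C : F →L[ℝ] F →L[ℝ] ℝ} (hC : IsLorentz C) {τ : E} {σ : F}
    {A : E →L[ℝ] F} (hA : Function.Surjective A)
    (hAτ : Set.MapsTo A (causalCone B τ) (causalCone C σ)) {k : E} (hk : 0 < B k k)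
    (hkτ : 0 < B τ k) : 0 < C (A k) (A k) := by
  -- If `A k` were null, moving `k` by `-ε • w` would stay in the open timelike cone while the image
  -- `A k - ε • σ` acquires negative square.
  obtain ⟨w, hw⟩ := hA σ
  have hAk := hAτ (show k ∈ causalCone B τ from ⟨hk.le, hkτ⟩)
  refine hAk.1.lt_of_ne fun h0 ↦ ?_
  have h1 : ∀ᶠ ε : ℝ in 𝓝 0, 0 < B k k - ε * (B k w + B w k) + ε ^ 2 * B w w := by
    have : Continuous fun ε : ℝ ↦ B k k - ε * (B k w + B w k) + ε ^ 2 * B w w := by fun_prop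
    exact this.continuousAt.eventually_const_lt (by simpa using hk)
  have h2 : ∀ᶠ ε : ℝ in 𝓝 0, 0 < B τ k - ε * B τ w := by
    have : Continuous fun ε : ℝ ↦ B τ k - ε * B τ w := by fun_prop
    exact this.continuousAt.eventually_const_lt (by simpa using hkτ)
  have h3 : ∀ᶠ ε : ℝ in 𝓝 0, 0 < 2 * C σ (A k) - ε * C σ σ := by
    have : Continuous fun ε : ℝ ↦ 2 * C σ (A k) - ε * C σ σ := by fun_prop
    exact this.continuousAt.eventually_const_lt (by simpa using hAk.2)
  obtain ⟨ε, ⟨⟨h1, h2⟩, h3⟩, hε⟩ := (((h1.and h2).and h3).filter_mono nhdsWithin_le_nhds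
    |>.and (self_mem_nhdsWithin (s := Set.Ioi (0 : ℝ)))).exists
  have h4 : k - ε • w ∈ causalCone B τ := by
    refine ⟨?_, by simpa using h2⟩
    have : B (k - ε • w) (k - ε • w) = B k k - ε * (B k w + B w k) + ε ^ 2 * B w w := by
      simp; ring
    rw [this]; exact h1.le
  have h5 := (hAτ h4).1
  have h6 : C (A (k - ε • w)) (A (k - ε • w)) = - ε * (2 * C σ (A k) - ε * C σ σ) := by
    simp [hw, ← h0, hC.symm (A k) σ]; ring
  nlinarith [mul_pos hε h3]

/-- A bilinear form which is nonnegative on the future cone and vanishes on the null vector `k` of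
it has `k` as an eigenvector. -/
theorem IsLorentz.exists_eigenvalue (hB : IsLorentz B) {τ : E}
    {T : LinearMap.BilinForm ℝ E} (hTs : ∀ v w, T v w = T w v)
    (hT : ∀ v ∈ causalCone B τ, 0 ≤ T v v) {k : E} (hk : k ∈ causalCone B τ) (hkk : B k k = 0)
    (hTk : T k k = 0) : ∃ c : ℝ, ∀ v, T v k = c * B v k := by
  have hτk := hk.2
  -- First-order minimality at `k`: `T` is tested on the curve `k + ε • v + (a * ε ^ 2) • τ`, whose
  -- `T`-square is `2 ε T(v, k)` to leading order.
  have key : ∀ v, B v k = 0 → 0 ≤ T v k := by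
    intro v hv
    have hkv : B k v = 0 := by rw [hB.symm, hv]
    -- With this `a` the curve has `B`-square `ε² (1 + O(ε))`, so it enters the cone even though `v`
    -- is only tangent to it.
    obtain ⟨a, ha⟩ : ∃ a : ℝ, B v v + 2 * a * B τ k = 1 :=
      ⟨(1 - B v v) / (2 * B τ k), by field_simp; ring⟩
    have h1 : ∀ᶠ ε : ℝ in 𝓝 0, 0 < 1 + ε * (2 * a * B v τ) + ε ^ 2 * (a ^ 2 * B τ τ) := by
      have : Continuous fun ε : ℝ ↦ 1 + ε * (2 * a * B v τ) + ε ^ 2 * (a ^ 2 * B τ τ) := by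
        fun_prop
      exact this.continuousAt.eventually_const_lt (by simp)
    have h2 : ∀ᶠ ε : ℝ in 𝓝 0, 0 < B τ k + ε * B τ v + a * ε ^ 2 * B τ τ := by
      have : Continuous fun ε : ℝ ↦ B τ k + ε * B τ v + a * ε ^ 2 * B τ τ := by fun_prop
      exact this.continuousAt.eventually_const_lt (by simpa using hτk)
    by_contra! hneg
    have h3 : ∀ᶠ ε : ℝ in 𝓝 0, 2 * T v k + ε * (T v v + 2 * a * T τ k) +
        ε ^ 2 * (2 * a * T v τ) + ε ^ 3 * (a ^ 2 * T τ τ) < 0 := by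
      have : Continuous fun ε : ℝ ↦ 2 * T v k + ε * (T v v + 2 * a * T τ k) +
        ε ^ 2 * (2 * a * T v τ) + ε ^ 3 * (a ^ 2 * T τ τ) := by fun_prop
      exact this.continuousAt.eventually_lt_const (by simp; linarith)
    obtain ⟨ε, ⟨⟨h1, h2⟩, h3⟩, hε⟩ := (((h1.and h2).and h3).filter_mono nhdsWithin_le_nhds
      |>.and (self_mem_nhdsWithin (s := Set.Ioi (0 : ℝ)))).exists
    have h4 : k + ε • v + (a * ε ^ 2) • τ ∈ causalCone B τ := by
      refine ⟨?_, by simpa using h2⟩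
      have : B (k + ε • v + (a * ε ^ 2) • τ) (k + ε • v + (a * ε ^ 2) • τ)
          = ε ^ 2 * (1 + ε * (2 * a * B v τ) + ε ^ 2 * (a ^ 2 * B τ τ)) := by
        rw [← ha]
        simp [hkk, hkv, hv, hB.symm k τ, hB.symm τ v]; ring
      rw [this]; positivity
    have h5 := hT _ h4
    have h6 : T (k + ε • v + (a * ε ^ 2) • τ) (k + ε • v + (a * ε ^ 2) • τ)
        = ε * (2 * T v k + ε * (T v v + 2 * a * T τ k) +
        ε ^ 2 * (2 * a * T v τ) + ε ^ 3 * (a ^ 2 * T τ τ)) := by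
      simp [hTk, hTs k τ, hTs k v, hTs τ v]; ring
    nlinarith [mul_neg_of_pos_of_neg hε h3]
  have key0 : ∀ v, B v k = 0 → T v k = 0 := fun v hv ↦
    le_antisymm (by simpa using key (-v) (by simpa using hv)) (key v hv)
  refine ⟨T τ k / B τ k, fun v ↦ ?_⟩
  -- Projection along `τ` onto the hyperplane orthogonal to `k`, where `T · k` vanishes.
  have := key0 (v - (B v k / B τ k) • τ) (by simp [hτk.ne'])
  simp only [map_sub, map_smul, LinearMap.sub_apply, LinearMap.smul_apply, smul_eq_mul] at this
  rw [sub_eq_zero.1 this]; ring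

end LorentzForm

/-! ### Analytic continuation on an interval. -/

/-- Identity theorem for a function that is analytic on an interval, endpoints included. -/
theorem eqOn_zero_of_contDiffOn_omega {J : Set ℝ} (hJ : J.OrdConnected) {h : ℝ → ℝ}
    (hh : ContDiffOn ℝ ω h J) {a b : ℝ} (ha : a ∈ J) (hb : b ∈ J) (hab : a < b)
    (h0 : ∀ s ∈ Set.Icc a b, h s = 0) : ∀ s ∈ J, h s = 0 := by
  have hconv : Convex ℝ J := hJ.convex
  have hsub : Set.Ioo a b ⊆ interior J :=
    interior_maximal (Set.Ioo_subset_Icc_self.trans (hJ.out ha hb)) isOpen_Ioo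
  have han : AnalyticOnNhd ℝ h (interior J) := by
    rw [← isOpen_interior.analyticOn_iff_analyticOnNhd]
    exact (hh.mono interior_subset).analyticOn
  have hmid : (a + b) / 2 ∈ Set.Ioo a b := ⟨by linarith, by linarith⟩
  have hint : Set.EqOn h 0 (interior J) :=
    han.eqOn_zero_of_preconnected_of_eventuallyEq_zero hconv.interior.isPreconnected
      (hsub hmid) (by
        filter_upwards [isOpen_Ioo.mem_nhds hmid] with s hs using h0 s (Set.Ioo_subset_Icc_self hs))
  -- Endpoints belonging to `J` are reached by continuity, since `a < b` gives `J` nonempty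
  -- interior.
  have hcl : J ⊆ closure (interior J) := by
    rw [hconv.closure_interior_eq_closure_of_nonempty_interior ⟨_, hsub hmid⟩]
    exact subset_closure
  exact fun s hs ↦ Set.EqOn.of_subset_closure hint hh.continuousOn continuousOn_const
    interior_subset hcl hs

/-! ### Families of tangent vectors preserved by differentials. -/

variable {n : ℕ} {V : Type*} [TopologicalSpace V] [ChartedSpace (EuclideanSpace ℝ (Fin n)) V]

theorem image_eq_of_mem_iff {α : Type*} {f : α → α} (hf : Function.Surjective f) {S : Set α}
    (h : ∀ x, f x ∈ S ↔ x ∈ S) : f '' S = S := by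
  conv_lhs => rw [show S = f ⁻¹' S from Set.ext fun x ↦ (h x).symm]
  exact Set.image_preimage_eq S hf

theorem mfderiv_diffeomorph_bijective (ψ : V ≃ₘ⟮𝓡 n, 𝓡 n⟯ V) (x : V) :
    Function.Bijective (mfderiv (𝓡 n) (𝓡 n) ψ x) := by
  rw [← ψ.mfderivToContinuousLinearEquiv_coe (by simp)]
  exact (ψ.mfderivToContinuousLinearEquiv (by simp) (x := x)).bijective

theorem mdifferentiable_diffeomorph (ψ : V ≃ₘ⟮𝓡 n, 𝓡 n⟯ V) :
    MDifferentiable (𝓡 n) (𝓡 n) ψ := ψ.mdifferentiable (by simp)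

/-- The differential of `f` restricts to a bijection between the members of the family `M` of sets
of tangent vectors. -/
def PreservesDirections (M : ∀ x : V, Set (TangentSpace (𝓡 n) x)) (f : V → V) : Prop :=
  ∀ x, Set.BijOn (mfderiv (𝓡 n) (𝓡 n) f x) (M x) (M (f x))

theorem PreservesDirections.comp {M : ∀ x : V, Set (TangentSpace (𝓡 n) x)} {f₁ f₂ : V → V}
    (h₁ : PreservesDirections M f₁) (h₂ : PreservesDirections M f₂)
    (hf₁ : MDifferentiable (𝓡 n) (𝓡 n) f₁) (hf₂ : MDifferentiable (𝓡 n) (𝓡 n) f₂) :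
    PreservesDirections M (f₁ ∘ f₂) := fun x ↦ by
  rw [mfderiv_comp x (hf₁ _) (hf₂ x)]
  exact (h₁ (f₂ x)).comp (h₂ x)

theorem preservesDirections_id (M : ∀ x : V, Set (TangentSpace (𝓡 n) x)) :
    PreservesDirections M id := fun x ↦ by
  rw [mfderiv_id]
  exact Set.bijOn_id _

theorem PreservesDirections.of_leftInverse {M : ∀ x : V, Set (TangentSpace (𝓡 n) x)}
    {f₁ f₂ : V → V} (h₂ : PreservesDirections M f₂)
    (hf₁ : MDifferentiable (𝓡 n) (𝓡 n) f₁) (hf₂ : MDifferentiable (𝓡 n) (𝓡 n) f₂)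
    (hsurj : Function.Surjective f₂) (hinv : f₁ ∘ f₂ = id) : PreservesDirections M f₁ := by
  intro y
  obtain ⟨x, rfl⟩ := hsurj y
  have hcomp : Set.BijOn (mfderiv (𝓡 n) (𝓡 n) f₁ (f₂ x) ∘ mfderiv (𝓡 n) (𝓡 n) f₂ x)
      (M x) (M ((f₁ ∘ f₂) x)) := by
    have h := preservesDirections_id M x
    rw [← hinv, mfderiv_comp x (hf₁ _) (hf₂ x)] at h
    exact h
  refine ⟨fun k hk ↦ ?_, fun k hk l hl hkl ↦ ?_, fun k hk ↦ ?_⟩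
  · obtain ⟨k₀, hk₀, rfl⟩ := (h₂ x).surjOn hk
    exact hcomp.mapsTo hk₀
  · obtain ⟨k₀, hk₀, rfl⟩ := (h₂ x).surjOn hk
    obtain ⟨l₀, hl₀, rfl⟩ := (h₂ x).surjOn hl
    rw [hcomp.injOn hk₀ hl₀ hkl]
  · obtain ⟨l, hl, rfl⟩ := hcomp.surjOn hk
    exact ⟨_, (h₂ x).mapsTo hl, rfl⟩

theorem PreservesDirections.finrank_span {M : ∀ x : V, Set (TangentSpace (𝓡 n) x)}
    {ψ : V ≃ₘ⟮𝓡 n, 𝓡 n⟯ V} (h : PreservesDirections M ψ) (x : V) :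
    Module.finrank ℝ (Submodule.span ℝ (M (ψ x))) = Module.finrank ℝ (Submodule.span ℝ (M x)) := by
  rw [← (h x).image_eq]
  change Module.finrank ℝ (Submodule.span ℝ
    ((mfderiv (𝓡 n) (𝓡 n) ψ x).toLinearMap '' M x)) = _
  rw [Submodule.span_image]
  exact (Submodule.equivMapOfInjective _ (mfderiv_diffeomorph_bijective ψ x).1 _).symm.finrank_eq

/-! ### Analyticity of the pulled-back metric, and null eigenvectors of causal symmetries. -/

variable {J : Set ℝ} {φ : ℝ → (V ≃ₘ⟮𝓡 n, 𝓡 n⟯ V)}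

theorem IsAnalyticOneParameterGroup.coe_add (hφ : IsAnalyticOneParameterGroup J φ) {s t : ℝ} (hs : s ∈ J) (ht : t ∈ J)
    (hst : s + t ∈ J) : ⇑(φ (s + t)) = φ s ∘ φ t := funext (hφ.map_add s hs t ht hst)

theorem IsAnalyticOneParameterGroup.mem_of_le (hφ : IsAnalyticOneParameterGroup J φ) {r s : ℝ} (hs : s ∈ J) (hr : 0 ≤ r)
    (hrs : r ≤ s) : r ∈ J := hφ.interval.out hφ.zero_mem hs ⟨hr, hrs⟩

variable [IsManifold (𝓡 n) ω V] {g : AnalyticLorentzMetric n V} {o : CausalOrientation g}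

theorem IsAnalyticOneParameterGroup.contDiffOn_pullbackMetric
    (hφ : IsAnalyticOneParameterGroup J φ) (x : V) (k : TangentSpace (𝓡 n) x) :
    ContDiffOn ℝ ω (fun s ↦ pullbackMetric g (φ s) x k k) J := by
  rw [← contMDiffOn_iff_contDiffOn]
  intro s hs
  have hf : ContMDiffWithinAt (𝓘(ℝ, ℝ).prod (𝓡 n)) (𝓡 n) ω
      (Function.uncurry fun (s : ℝ) (x : V) ↦ φ s x) (J ×ˢ Set.univ) (s, x) :=
    hφ.analytic (s, x) ⟨hs, trivial⟩
  have hbase : ContMDiffWithinAt 𝓘(ℝ, ℝ) (𝓡 n) ω (fun s ↦ φ s x) J s :=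
    hf.comp (f := fun t : ℝ ↦ (t, x)) s (contMDiffWithinAt_id.prodMk contMDiffWithinAt_const)
      fun t (ht : t ∈ J) ↦ (⟨ht, trivial⟩ : (t, x) ∈ J ×ˢ Set.univ)
  -- The spatial derivative of the flow is again analytic in `s`; no order is lost because `ω + 1 ≤
  -- ω`.
  have hd := ContMDiffWithinAt.mfderivWithin (m := ω) (g := fun _ ↦ x) hf
    contMDiffWithinAt_const hs (fun _ _ ↦ trivial) le_rfl uniqueMDiffOn_univ
  have hconst : ContMDiffWithinAt 𝓘(ℝ, ℝ) (𝓡 n).tangent ω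
      (fun _ : ℝ ↦ (⟨x, k⟩ : TangentBundle (𝓡 n) V)) J s := contMDiffWithinAt_const
  have hv : ContMDiffWithinAt 𝓘(ℝ, ℝ) (𝓡 n).tangent ω
      (fun s ↦ (⟨φ s x, mfderiv (𝓡 n) (𝓡 n) (φ s) x k⟩ : TangentBundle (𝓡 n) V)) J s := by
    simp only [mfderivWithin_univ] at hd
    exact ContMDiffWithinAt.clm_apply_of_inCoordinates (b₁ := fun _ : ℝ ↦ x) hd hconst hbase
  have := ContMDiffWithinAt.clm_bundle_apply₂ (F₁ := EuclideanSpace ℝ (Fin n))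
    (F₂ := EuclideanSpace ℝ (Fin n)) (F₃ := ℝ) (E₃ := Bundle.Trivial V ℝ)
    (g.analytic.contMDiffAt.comp_contMDiffWithinAt s hbase) hv hv
  simp only [Bundle.contMDiffWithinAt_totalSpace] at this
  exact this.2

theorem AnalyticLorentzMetric.isLorentz (g : AnalyticLorentzMetric n V) (x : V) :
    IsLorentz (g.val x) := ⟨g.symm x, g.signature x⟩

/-- A causal symmetry maps timelike vectors to timelike vectors. -/
theorem IsCausalSymmetry.null_of_pullback_null {ψ : V ≃ₘ⟮𝓡 n, 𝓡 n⟯ V}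
    (hψ : IsCausalSymmetry o ψ) {x : V} {k : TangentSpace (𝓡 n) x} (hk : k ∈ futureCone o x)
    (h0 : pullbackMetric g ψ x k k = 0) : g.val x k k = 0 := by
  by_contra h
  exact ((g.isLorentz (ψ x)).pos_of_mapsTo_causalCone (mfderiv_diffeomorph_bijective ψ x).2
    (hψ x) (hk.1.lt_of_ne' h) hk.2).ne' h0

/-- A canonical null direction minimises the pull-back on the cone, hence is an eigenvector.
Conversely the eigenvalue equation at a null `k` gives `T k k = 0`, and one of `k`, `-k` is
future-directed. -/
theorem nullEigenvectors_eq {ψ : V ≃ₘ⟮𝓡 n, 𝓡 n⟯ V} (hψ : IsCausalSymmetry o ψ) (x : V) :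
    nullEigenvectors g (pullbackMetric g ψ x) =
      canonicalNullDirections o ψ x ∪ -canonicalNullDirections o ψ x := by
  have hpos : canonicalNullDirections o ψ x ⊆ nullEigenvectors g (pullbackMetric g ψ x) := by
    rintro k ⟨hk, hTk⟩
    have hkk := hψ.null_of_pullback_null hk hTk
    refine ⟨?_, hkk, (g.isLorentz x).exists_eigenvalue (τ := o.field x)
      (fun v w ↦ g.symm _ _ _) (fun v hv ↦ (hψ x v hv).1) hk hkk hTk⟩
    rintro rfl
    exact hk.2.ne' (by simp)
  have hneg : ∀ k, -k ∈ nullEigenvectors g (pullbackMetric g ψ x) →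
      k ∈ nullEigenvectors g (pullbackMetric g ψ x) := by
    rintro k ⟨h0, hk, c, hc⟩
    exact ⟨by simpa using h0, by simpa using hk, c, fun v ↦ by simpa using hc v⟩
  refine Set.Subset.antisymm ?_ (Set.union_subset hpos fun k hk ↦ hneg k (hpos hk))
  rintro k ⟨h0, hk, c, hc⟩
  have hT : pullbackMetric g ψ x k k = 0 := by rw [hc, hk, mul_zero]
  rcases (g.isLorentz x).mem_causalCone_or_neg_mem (o.timelike x) hk.ge h0 with h | h
  · exact Or.inl ⟨h, hT⟩
  · exact Or.inr ⟨h, by simpa using hT⟩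

theorem span_nullEigenvectors {ψ : V ≃ₘ⟮𝓡 n, 𝓡 n⟯ V} (hψ : IsCausalSymmetry o ψ) (x : V) :
    Submodule.span ℝ (nullEigenvectors g (pullbackMetric g ψ x)) =
      Submodule.span ℝ (canonicalNullDirections o ψ x) := by
  rw [nullEigenvectors_eq hψ, Submodule.span_union, Submodule.span_neg, sup_idem]

theorem mem_setN_iff {ψ : V ≃ₘ⟮𝓡 n, 𝓡 n⟯ V} (hψ : IsCausalSymmetry o ψ) {m : ℕ} {x : V} :
    x ∈ setN g ψ m ↔
      Module.finrank ℝ (Submodule.span ℝ (canonicalNullDirections o ψ x)) = m := by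
  rw [setN, Set.mem_ofPred_eq, span_nullEigenvectors hψ]

/-! ### Canonical null directions along the flow. -/

namespace IsAnalyticOneParameterGroup

theorem pullbackMetric_add (hφ : IsAnalyticOneParameterGroup J φ) {s t : ℝ} (hs : s ∈ J)
    (ht : t ∈ J) (hst : s + t ∈ J) (x : V) (k : TangentSpace (𝓡 n) x) :
    pullbackMetric g (φ (s + t)) x k k = pullbackMetric g (φ s) (φ t x)
      (mfderiv (𝓡 n) (𝓡 n) (φ t) x k) (mfderiv (𝓡 n) (𝓡 n) (φ t) x k) := by
  change g.val (φ (s + t) x) (mfderiv (𝓡 n) (𝓡 n) (φ (s + t)) x k)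
    (mfderiv (𝓡 n) (𝓡 n) (φ (s + t)) x k) = _
  rw [hφ.coe_add hs ht hst, mfderiv_comp x (mdifferentiable_diffeomorph _ _)
    (mdifferentiable_diffeomorph _ _)]
  rfl

theorem pullbackMetric_zero (hφ : IsAnalyticOneParameterGroup J φ) (x : V)
    (k : TangentSpace (𝓡 n) x) : pullbackMetric g (φ 0) x k k = g.val x k k := by
  change g.val (φ 0 x) (mfderiv (𝓡 n) (𝓡 n) (φ 0) x k) (mfderiv (𝓡 n) (𝓡 n) (φ 0) x k) = _
  rw [show ⇑(φ 0) = id from funext hφ.map_zero, mfderiv_id]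
  rfl

variable (hφ : IsAnalyticOneParameterGroup J φ)
  (hcausal : ∀ s ∈ J, 0 ≤ s → IsCausalSymmetry o (φ s))
include hφ hcausal

/-- Were the push-forward of `k` by `φ r` timelike, `φ (s - r)` would keep it timelike,
contradicting nullity at `s`. -/
theorem pullback_null_of_le {r s : ℝ} (hs : s ∈ J) (hr : 0 ≤ r) (hrs : r ≤ s) {x : V}
    {k : TangentSpace (𝓡 n) x} (hk : k ∈ canonicalNullDirections o (φ s) x) :
    pullbackMetric g (φ r) x k k = 0 := by
  have hrJ := hφ.mem_of_le hs hr hrs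
  have hsr : s - r ∈ J := hφ.mem_of_le hs (by linarith) (by linarith)
  refine (hcausal (s - r) hsr (by linarith)).null_of_pullback_null
    (hcausal r hrJ hr x k hk.1) ?_
  rw [← hφ.pullbackMetric_add hsr hrJ (by simpa using hs), sub_add_cancel]
  exact hk.2

/-- A canonical null direction stays null for all parameter values, by analyticity. -/
theorem pullback_null {s : ℝ} (hs : s ∈ J) (hs0 : 0 < s) {x : V} {k : TangentSpace (𝓡 n) x}
    (hk : k ∈ canonicalNullDirections o (φ s) x) :
    ∀ r ∈ J, pullbackMetric g (φ r) x k k = 0 :=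
  eqOn_zero_of_contDiffOn_omega hφ.interval (hφ.contDiffOn_pullbackMetric x k) hφ.zero_mem hs hs0
    fun _ hr ↦ hφ.pullback_null_of_le hcausal hs hr.1 hr.2 hk

theorem canonicalNullDirections_eq {s t : ℝ} (hs : s ∈ J) (hs0 : 0 < s) (ht : t ∈ J)
    (ht0 : 0 < t) (x : V) :
    canonicalNullDirections o (φ s) x = canonicalNullDirections o (φ t) x :=
  Set.Subset.antisymm (fun _ hk ↦ ⟨hk.1, hφ.pullback_null hcausal hs hs0 hk t ht⟩)
    fun _ hk ↦ ⟨hk.1, hφ.pullback_null hcausal ht ht0 hk s hs⟩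

/-- If `t` is not the largest parameter value, the differential of `φ t` permutes the canonical null
directions. -/
theorem preservesDirections_of_add_mem {t : ℝ} (ht0 : 0 < t) (h2t : t + t ∈ J) :
    PreservesDirections (canonicalNullDirections o (φ t)) (φ t) := by
  have ht : t ∈ J := hφ.mem_of_le h2t ht0.le (by linarith)
  have hc := hcausal t ht ht0.le
  intro x
  refine ⟨fun k hk ↦ ⟨hc x k hk.1, ?_⟩, (mfderiv_diffeomorph_bijective (φ t) x).1.injOn,
    fun k' hk' ↦ ?_⟩
  · rw [← hφ.pullbackMetric_add ht ht h2t]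
    exact hφ.pullback_null hcausal ht ht0 hk _ h2t
  · obtain ⟨k, rfl⟩ := (mfderiv_diffeomorph_bijective (φ t) x).2 k'
    -- The hypothesis on the image of `k` gives vanishing on `[t, 2t]` only; analyticity carries it
    -- back to `0`, so that `k` itself is null.
    have hnull : ∀ r ∈ J, pullbackMetric g (φ r) x k k = 0 := by
      refine eqOn_zero_of_contDiffOn_omega hφ.interval (hφ.contDiffOn_pullbackMetric x k) ht h2t
        (by linarith) fun r hr ↦ ?_
      have hrt : r - t ∈ J := hφ.mem_of_le ht (by linarith [hr.1]) (by linarith [hr.2])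
      have h := hφ.pullbackMetric_add (g := g) hrt ht
        (by simpa using hφ.interval.out ht h2t hr) x k
      rw [sub_add_cancel] at h
      rw [h]
      exact hφ.pullback_null hcausal ht ht0 hk' _ hrt
    have hkk : g.val x k k = 0 := by
      rw [← hφ.pullbackMetric_zero x k]
      exact hnull 0 hφ.zero_mem
    have hk0 : k ≠ 0 := by
      rintro rfl
      exact hk'.1.2.ne' (by simp)
    refine ⟨k, ⟨?_, hnull t ht⟩, rfl⟩
    -- If `-k` were future-directed, both the image of `k` and its negative would be.
    refine ((g.isLorentz x).mem_causalCone_or_neg_mem (o.timelike x) hkk.ge hk0).resolve_right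
      fun hneg ↦ ?_
    have h1 := (hc x (-k) hneg).2
    have h2 := hk'.1.2
    simp only [map_neg] at h1
    linarith

theorem preservesDirections_of_pos {s₀ s : ℝ} (hs₀ : s₀ ∈ J) (hs₀0 : 0 < s₀) (hs : s ∈ J)
    (hs0 : 0 < s) : PreservesDirections (canonicalNullDirections o (φ s₀)) (φ s) := by
  -- `2s` may lie outside `J`, so the previous lemma is applied at `s / 2` and composed with itself.
  have hh : s / 2 ∈ J := hφ.mem_of_le hs (by linarith) (by linarith)
  have h2 : s / 2 + s / 2 ∈ J := by simpa using hs
  have h := hφ.preservesDirections_of_add_mem hcausal (half_pos hs0) h2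
  rw [show canonicalNullDirections o (φ (s / 2)) = canonicalNullDirections o (φ s₀) from
    funext (hφ.canonicalNullDirections_eq hcausal hh (half_pos hs0) hs₀ hs₀0)] at h
  have hadd := hφ.coe_add hh hh h2
  rw [add_halves] at hadd
  rw [hadd]
  exact h.comp h (mdifferentiable_diffeomorph _) (mdifferentiable_diffeomorph _)

theorem preservesDirections {s₀ s : ℝ} (hs₀ : s₀ ∈ J) (hs₀0 : 0 < s₀) (hs : s ∈ J) :
    PreservesDirections (canonicalNullDirections o (φ s₀)) (φ s) := by
  have hφ0 : ⇑(φ 0) = id := funext hφ.map_zero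
  rcases lt_trichotomy s 0 with hs0 | rfl | hs0
  -- `-s` need not lie in `J`. With `N > -s / s₀` the step `-(s / N)` is below `s₀`, hence in `J`,
  -- and `φ (s / N)` inverts a positive-time map; `φ s` is its `N`-fold iterate.
  · obtain ⟨N, hN⟩ := exists_nat_gt (-s / s₀)
    have hN0 : (0 : ℝ) < N := (div_pos (by linarith) hs₀0).trans hN
    have hsN : s / N < 0 := div_neg_of_neg_of_pos hs0 hN0
    have hmem : ∀ m : ℕ, m ≤ N → m * (s / N) ∈ J := by
      intro m hm
      have hm' : (m : ℝ) ≤ N := by exact_mod_cast hm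
      refine hφ.interval.out hs hφ.zero_mem
        ⟨?_, mul_nonpos_of_nonneg_of_nonpos m.cast_nonneg hsN.le⟩
      calc s = N * (s / N) := by field_simp
        _ ≤ m * (s / N) := mul_le_mul_of_nonpos_right hm' hsN.le
    have h1 : s / N ∈ J := by simpa using hmem 1 (by exact_mod_cast hN0)
    have h1' : -(s / N) ∈ J := by
      refine hφ.mem_of_le hs₀ (by linarith) ?_
      rw [← neg_div, div_le_iff₀ hN0, mul_comm]
      exact ((div_lt_iff₀ hs₀0).1 hN).le
    have hstep : PreservesDirections (canonicalNullDirections o (φ s₀)) (φ (s / N)) := by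
      refine (hφ.preservesDirections_of_pos hcausal hs₀ hs₀0 h1' (by linarith)).of_leftInverse
        (mdifferentiable_diffeomorph _) (mdifferentiable_diffeomorph _) (φ _).surjective ?_
      rw [← hφ.coe_add h1 h1' (by simpa using hφ.zero_mem), add_neg_cancel, hφ0]
    have hall : ∀ m : ℕ, m ≤ N →
        PreservesDirections (canonicalNullDirections o (φ s₀)) (φ (m * (s / N))) := by
      intro m
      induction m with
      | zero => intro _; simpa [hφ0] using preservesDirections_id _
      | succ m ih =>
        intro hm
        have hms := hmem (m + 1) hm
        have heq : ((m + 1 : ℕ) : ℝ) * (s / N) = s / N + m * (s / N) := by push_cast; ring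
        rw [heq] at hms ⊢
        rw [hφ.coe_add h1 (hmem m (by omega)) hms]
        exact hstep.comp (ih (by omega)) (mdifferentiable_diffeomorph _)
          (mdifferentiable_diffeomorph _)
    have := hall N le_rfl
    rwa [mul_div_cancel₀ _ hN0.ne'] at this
  · rw [hφ0]
    exact preservesDirections_id _
  · exact hφ.preservesDirections_of_pos hcausal hs₀ hs₀0 hs hs0

end IsAnalyticOneParameterGroup

end CausalSymmetry

end

open CausalSymmetry in
theorem mainTheorem7 {n : ℕ} {V : Type*} [TopologicalSpace V]
    [ChartedSpace (EuclideanSpace ℝ (Fin n)) V] [IsManifold (𝓡 n) ω V]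
    (g : AnalyticLorentzMetric n V) (o : CausalOrientation g)
    (J : Set ℝ) (φ : ℝ → (V ≃ₘ⟮𝓡 n, 𝓡 n⟯ V)) (hφ : IsAnalyticOneParameterGroup J φ)
    (hcausal : ∀ s ∈ J, 0 ≤ s → IsCausalSymmetry o (φ s)) :
    -- the canonical null directions, and the sets 𝒰, 𝒩^m, 𝒩, do not depend on the parameter
    (∀ s₀ ∈ J, 0 < s₀ → ∀ s₁ ∈ J, 0 < s₁ →
      (∀ x : V, canonicalNullDirections o (φ s₀) x = canonicalNullDirections o (φ s₁) x) ∧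
      setU o (φ s₀) = setU o (φ s₁) ∧
      (∀ m : ℕ, setN g (φ s₀) m = setN g (φ s₁) m) ∧
      setNUnion g (φ s₀) = setNUnion g (φ s₁)) ∧
    -- they are invariant under the flow
    (∀ s₀ ∈ J, 0 < s₀ → ∀ s ∈ J,
      φ s '' setU o (φ s₀) = setU o (φ s₀) ∧
      (∀ m : ℕ, φ s '' setN g (φ s₀) m = setN g (φ s₀) m) ∧
      φ s '' setNUnion g (φ s₀) = setNUnion g (φ s₀) ∧
      ∀ x : V, Set.BijOn (mfderiv (𝓡 n) (𝓡 n) (φ s) x)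
        (canonicalNullDirections o (φ s₀) x)
        (canonicalNullDirections o (φ s₀) (φ s x))) := by
  have hN : ∀ s₀ ∈ J, 0 < s₀ → ∀ s₁ ∈ J, 0 < s₁ → ∀ m : ℕ,
      setN g (φ s₀) m = setN g (φ s₁) m := by
    intro s₀ h₀ hp₀ s₁ h₁ hp₁ m
    ext x
    rw [mem_setN_iff (hcausal s₀ h₀ hp₀.le), mem_setN_iff (hcausal s₁ h₁ hp₁.le),
      hφ.canonicalNullDirections_eq hcausal h₀ hp₀ h₁ hp₁]
  refine ⟨fun s₀ h₀ hp₀ s₁ h₁ hp₁ ↦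
    ⟨hφ.canonicalNullDirections_eq hcausal h₀ hp₀ h₁ hp₁, ?_, hN s₀ h₀ hp₀ s₁ h₁ hp₁, ?_⟩,
    fun s₀ h₀ hp₀ s hs ↦ ?_⟩
  · ext x
    rw [setU, setU, Set.mem_ofPred_eq, Set.mem_ofPred_eq,
      hφ.canonicalNullDirections_eq hcausal h₀ hp₀ h₁ hp₁]
  · simp only [setNUnion, hN s₀ h₀ hp₀ s₁ h₁ hp₁]
  · have hpres := hφ.preservesDirections hcausal h₀ hp₀ hs
    have hmem : ∀ m x, φ s x ∈ setN g (φ s₀) m ↔ x ∈ setN g (φ s₀) m := fun m x ↦ by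
      rw [mem_setN_iff (hcausal s₀ h₀ hp₀.le), mem_setN_iff (hcausal s₀ h₀ hp₀.le),
        hpres.finrank_span]
    refine ⟨image_eq_of_mem_iff (f := φ s) (φ s).surjective fun x ↦ ?_,
      fun m ↦ image_eq_of_mem_iff (f := φ s) (φ s).surjective (hmem m),
      image_eq_of_mem_iff (f := φ s) (φ s).surjective fun x ↦ ?_, hpres⟩
    · rw [setU, Set.mem_ofPred_eq, Set.mem_ofPred_eq, ← (hpres x).image_eq, Set.image_eq_empty]
    · simp only [setNUnion, Set.mem_iUnion, hmem]
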